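/- Let $n \ge 0$ and $k\ge 1$, let $K$ be a field with $\operatorname{char}(K)=0$ or $\operatorname{char}(K)>k$, let $A=K[X_1,\dots,X_n]$, let $\mathfrak{q}=\langle X_1,\dots,X_n\rangle$, and let $S=A/\mathfrak{q}^k$. For a $K$-algebra $R$ and $m\ge 0$, let $\Omega^m_{R/K}=\Lambda^m_R\,\Omega^1_{R/K}$ be the module of Kähler differential $m$-forms (so $\Omega^0_{R/K}=R$). Let $d\mathfrak{q}^k$ be the $A$-submodule of $\Omega^1_{A/K}$ generated by $\{df\mid f\in\mathfrak{q}^k\}$, and for $m\ge 1$ let $d\mathfrak{q}^k\wedge\Omega^{m-1}_{A/K}$ be the $A$-submodule of $\Omega^m_{A/K}$ generated by all $w\wedge\eta$ with $w\in d\mathfrak{q}^k$ and $\eta\in\Omega^{m-1}_{A/K}$. Grade $\Omega^m_{A/K}$ by the standard grading of $A$ and $\deg(dX_i)=1$, and write $(\;\cdot\;)_i$ for homogeneous components of degree $i$. Binomial coefficients $\binom{a}{b}$ with $a<0$ or $b<0$ are zero. (a) For every $m\ge 1$, the $K$-vector space $(d\mathfrak{q}^k\wedge\Omega^{m-1}_{A/K})_{m+k-1}$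 is finite-dimensional, and $$\dim_K (d\mathfrak{q}^k\wedge\Omega^{m-1}_{A/K})_{m+k-1}=\binom{n}{m}\binom{n+k-2}{n-1}-\binom{m+k-2}{m}\binom{n+k-2}{n-m-1}.$$ (b) For every $m\ge 1$, the $K$-vector space $\Omega^m_{S/K}$ is finite-dimensional, and $$\dim_K \Omega^m_{S/K}=\binom{n}{m}\binom{n+k-2}{n}+\binom{m+k-2}{m}\binom{n+k-2}{n-m-1}.$$ -/

import Mathlib

open scoped KaehlerDifferential

noncomputable section

/-- The binomial coefficient with integer entries, under the usual counting convention that it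
is zero if one of the entries is negative (or if the upper entry is less than the lower one). -/
def binom (a b : ℤ) : ℤ :=
  if 0 ≤ a ∧ 0 ≤ b then (Nat.choose a.toNat b.toNat : ℤ) else 0

/-- The module `Ω^m_{R/K}` of Kähler differential `m`-forms of the `K`-algebra `R`:
the `m`-th exterior power over `R` of the module of Kähler differentials,
as a submodule of the exterior algebra. For `m = 0` this is `R`. -/
abbrev kaehlerForms (K R : Type*) [CommRing K] [CommRing R] [Algebra K R] (m : ℕ) :
    Submodule R (ExteriorAlgebra R Ω[R⁄K]) :=
  ⋀[R]^m Ω[R⁄K]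

/-- For an ideal `I` of `R`, the `R`-submodule `dI` of `Ω^1_{R/K}` generated by all `df`
with `f ∈ I`. -/
def dIdeal (K : Type*) {R : Type*} [CommRing K] [CommRing R] [Algebra K R] (I : Ideal R) :
    Submodule R Ω[R⁄K] :=
  Submodule.span R (KaehlerDifferential.D K R '' (I : Set R))

/-- The `R`-submodule `dI ∧ Ω^l_{R/K}` of `Ω^{l+1}_{R/K}`: it is generated by all products
`w ∧ η` with `w ∈ dI` and `η ∈ Ω^l_{R/K}`. -/
def dIdealWedge (K : Type*) {R : Type*} [CommRing K] [CommRing R] [Algebra K R] (I : Ideal R)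
    (l : ℕ) : Submodule R (ExteriorAlgebra R Ω[R⁄K]) :=
  (dIdeal K I).map (ExteriorAlgebra.ι R) * kaehlerForms K R l

/-- The homogeneous component of degree `i` of `Ω^m_{A/K}` for `A = K[X_1, …, X_n]`, with the
standard grading on `A` and with `deg (dX_j) = 1`: the `K`-span of all
`f dX_{s 1} ∧ ⋯ ∧ dX_{s m}` where `f` is homogeneous of degree `i - m`. -/
def formsComponent (K : Type*) [Field K] (n m i : ℕ) :
    Submodule K (ExteriorAlgebra (MvPolynomial (Fin n) K) Ω[MvPolynomial (Fin n) K⁄K]) :=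
  Submodule.span K
    {w | ∃ (e : ℕ) (f : MvPolynomial (Fin n) K) (s : Fin m → Fin n),
      e + m = i ∧ f.IsHomogeneous e ∧
      w = f • ExteriorAlgebra.ιMulti (MvPolynomial (Fin n) K) m
        (fun j => KaehlerDifferential.D K (MvPolynomial (Fin n) K) (MvPolynomial.X (s j)))}

/-- The homogeneous maximal ideal `⟨X_1, …, X_n⟩` of `K[X_1, …, X_n]`. -/
def maxIdeal (K : Type*) [Field K] (n : ℕ) : Ideal (MvPolynomial (Fin n) K) :=
  Ideal.span (Set.range MvPolynomial.X)

/-- The vector space `(d𝔮^k ∧ Ω^{m-1}_{A/K})_i`, for `A = K[X_1, …, X_n]`,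
`𝔮 = ⟨X_1, …, X_n⟩` and `m ≥ 1`. -/
def dPowWedgeComponent (K : Type*) [Field K] (n k m i : ℕ) :
    Submodule K (ExteriorAlgebra (MvPolynomial (Fin n) K) Ω[MvPolynomial (Fin n) K⁄K]) :=
  (dIdealWedge K (maxIdeal K n ^ k) (m - 1)).restrictScalars K ⊓ formsComponent K n m i

end

/-! Write k = j + 1, m = l + 1 and I = 𝔮^k. The kernel of Ω^m_A → Ω^m_{A/I} is dI ∧ Ω^{m-1} + I Ω^m
by the universal property, and the second summand lies in the first because f dg = d(fg) - g df.
Sorting by the degree of the coefficients, dI ∧ Ω^{m-1} is the sum of all m-forms with coefficients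
of degree at least k and of the exact forms d(Ω^{m-1} with coefficients of degree k), which have
coefficients of degree j (`dIdealWedge_eq`). So the space in (a) is this space of exact forms, and
Ω^m_S is the space of m-forms with coefficients of degree at most j modulo it.

It remains to find the rank of d on forms with coefficients of fixed degree. A Poincaré lemma says
that closed forms of positive form degree with coefficients of degree j are exact; rank-nullity then
gives a recursion for the ranks, which binomial identities solve. The usual homotopy with the full
Euler field would divide by the total degree j + m, which the characteristic may divide even if it
exceeds k. The fields X_i ∂/∂X_i are used one at a time instead: on a monomial form divisible by
dX_i, the weight in direction i lies between 1 and j + 1 = k, hence is invertible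
(`mem_map_formsDeriv_of_formsDeriv_eq_zero`). -/

/-- A derivation vanishing on an ideal `I` induces a derivation of the quotient by `I`. -/
noncomputable def Derivation.ofQuotient {K A M : Type*} [CommRing K] [CommRing A] [Algebra K A]
    {I : Ideal A} [AddCommGroup M] [Module K M] [Module A M] [Module (A ⧸ I) M]
    [IsScalarTower A (A ⧸ I) M] (d : Derivation K A M) (hd : ∀ f ∈ I, d f = 0) :
    Derivation K (A ⧸ I) M :=
  -- Values are taken on chosen representatives, so every axiom below reduces to an equality of
  -- classes modulo `I`.
  have key : ∀ f g : A, Ideal.Quotient.mk I f = Ideal.Quotient.mk I g → d f = d g :=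
    fun f g h => by
      rw [← sub_eq_zero, ← map_sub]
      exact hd _ (Ideal.Quotient.eq.mp h)
  Derivation.mk'
    { toFun := fun x => d (Quotient.out x)
      map_add' := fun x y => by
        rw [← map_add]
        refine key _ _ ?_
        rw [map_add, Ideal.Quotient.mk_out, Ideal.Quotient.mk_out, Ideal.Quotient.mk_out]
      map_smul' := fun r x => by
        rw [RingHom.id_apply, ← map_smul]
        refine key _ _ ?_
        rw [Ideal.Quotient.mk_out, ← Ideal.Quotient.mkₐ_eq_mk K,
          _root_.map_smul (Ideal.Quotient.mkₐ K I),
          Ideal.Quotient.mkₐ_eq_mk, Ideal.Quotient.mk_out] }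
    (fun x y => by
      have h : ∀ (z : A ⧸ I) (v : M), z • v = (Quotient.out z : A) • v := fun z v => by
        rw [← algebraMap_smul (A ⧸ I) (Quotient.out z : A) v, Ideal.Quotient.algebraMap_eq,
          Ideal.Quotient.mk_out]
      rw [h, h]
      change d _ = _ • d _ + _ • d _
      rw [← Derivation.leibniz]
      refine key _ _ ?_
      rw [map_mul, Ideal.Quotient.mk_out, Ideal.Quotient.mk_out, Ideal.Quotient.mk_out])

theorem Derivation.ofQuotient_mk {K A M : Type*} [CommRing K] [CommRing A] [Algebra K A]
    {I : Ideal A} [AddCommGroup M] [Module K M] [Module A M] [Module (A ⧸ I) M]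
    [IsScalarTower A (A ⧸ I) M] (d : Derivation K A M) (hd : ∀ f ∈ I, d f = 0) (f : A) :
    d.ofQuotient hd (Ideal.Quotient.mk I f) = d f := by
  change d _ = d f
  rw [← sub_eq_zero, ← map_sub]
  exact hd _ (Ideal.Quotient.eq.mp (Ideal.Quotient.mk_out _))

/-! ### Forms on a quotient ring and the kernel of the restriction map -/

section Quotient

variable {K A : Type*} [CommRing K] [CommRing A] [Algebra K A] (I : Ideal A)

/-- The map of exterior algebras induced by `Ω[A⁄K] → Ω[A ⧸ I⁄K]`. -/
noncomputable def formsQuotMap (K : Type*) {A : Type*} [CommRing K] [CommRing A] [Algebra K A]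
    (I : Ideal A) :
    ExteriorAlgebra A Ω[A⁄K] →ₐ[A] ExteriorAlgebra (A ⧸ I) Ω[A ⧸ I⁄K] :=
  ExteriorAlgebra.lift A
    ⟨(ExteriorAlgebra.ι (A ⧸ I)).restrictScalars A ∘ₗ KaehlerDifferential.map K K A (A ⧸ I),
      fun _ => ExteriorAlgebra.ι_sq_zero _⟩

@[simp]
theorem formsQuotMap_ι (w : Ω[A⁄K]) :
    formsQuotMap K I (ExteriorAlgebra.ι A w) =
      ExteriorAlgebra.ι (A ⧸ I) (KaehlerDifferential.map K K A (A ⧸ I) w) := by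
  exact ExteriorAlgebra.lift_ι_apply A _ _ _

theorem formsQuotMap_ιMulti (m : ℕ) (w : Fin m → Ω[A⁄K]) :
    formsQuotMap K I (ExteriorAlgebra.ιMulti A m w) =
      ExteriorAlgebra.ιMulti (A ⧸ I) m (fun i => KaehlerDifferential.map K K A (A ⧸ I) (w i)) := by
  simp [ExteriorAlgebra.ιMulti_apply, map_list_prod, List.map_ofFn, Function.comp_def]

theorem kaehlerForms_eq_map (m : ℕ) :
    (kaehlerForms K (A ⧸ I) m).restrictScalars A =
      (kaehlerForms K A m).map (formsQuotMap K I).toLinearMap := by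
  have hs : Function.Surjective (KaehlerDifferential.map K K A (A ⧸ I)) :=
    KaehlerDifferential.map_surjective_of_surjective K K A (A ⧸ I) Ideal.Quotient.mk_surjective
  rw [kaehlerForms, kaehlerForms, ← ExteriorAlgebra.ιMulti_span_fixedDegree,
    ← ExteriorAlgebra.ιMulti_span_fixedDegree, Submodule.map_span,
    Submodule.restrictScalars_span A (A ⧸ I) Ideal.Quotient.mk_surjective]
  congr 1
  ext x
  constructor
  · rintro ⟨w, rfl⟩
    choose v hv using fun i => hs (w i)
    exact ⟨_, ⟨v, rfl⟩, by simp [formsQuotMap_ιMulti, hv]⟩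
  · rintro ⟨_, ⟨w, rfl⟩, rfl⟩
    exact ⟨_, (formsQuotMap_ιMulti I m w).symm⟩

/-- f dg = d(fg) - g df, and the dg span. This is why I Ω^m adds nothing to dI ∧ Ω^{m-1} when m ≥ 1.
-/
theorem smul_mem_dIdeal {f : A} (hf : f ∈ I) (w : Ω[A⁄K]) : f • w ∈ dIdeal K I := by
  have hw : w ∈ Submodule.span A (Set.range (KaehlerDifferential.D K A)) := by
    rw [KaehlerDifferential.span_range_derivation]; trivial
  induction hw using Submodule.span_induction with
  | mem w hw =>
    obtain ⟨g, rfl⟩ := hw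
    have : f • KaehlerDifferential.D K A g =
        KaehlerDifferential.D K A (f * g) - g • KaehlerDifferential.D K A f := by
      simp
    rw [this]
    exact sub_mem (Submodule.subset_span ⟨_, I.mul_mem_right _ hf, rfl⟩)
      (Submodule.smul_mem _ _ (Submodule.subset_span ⟨_, hf, rfl⟩))
  | zero => simp
  | add x y _ _ hx hy => rw [smul_add]; exact add_mem hx hy
  | smul a x _ hx => rw [smul_comm]; exact Submodule.smul_mem _ _ hx

theorem smul_mem_dIdealWedge {f : A} (hf : f ∈ I) {l : ℕ} {x : ExteriorAlgebra A Ω[A⁄K]}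
    (hx : x ∈ kaehlerForms K A (l + 1)) : f • x ∈ dIdealWedge K I l := by
  rw [kaehlerForms, ExteriorAlgebra.exteriorPower, pow_succ'] at hx
  induction hx using Submodule.mul_induction_on' with
  | mem_mul_mem x hx y hy =>
    obtain ⟨w, rfl⟩ := hx
    rw [← smul_mul_assoc, ← map_smul]
    exact Submodule.mul_mem_mul ⟨_, smul_mem_dIdeal I hf w, rfl⟩ hy
  | add x _ y _ hx hy => rw [smul_add]; exact add_mem hx hy

/-- The two-sided ideal of forms that vanish on the quotient by `I`, as a submodule. -/
noncomputable def vanishingForms (K : Type*) {A : Type*} [CommRing K] [CommRing A] [Algebra K A]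
    (I : Ideal A) : Submodule A (ExteriorAlgebra A Ω[A⁄K]) :=
  (dIdeal K I).map (ExteriorAlgebra.ι A) * ⊤ ⊔ I • ⊤

/-- A one-form moves past a generator of `dI` at the cost of a sign, so the right ideal it generates
is also a left ideal. -/
theorem mul_mem_vanishingForms_left (a : ExteriorAlgebra A Ω[A⁄K]) {x : ExteriorAlgebra A Ω[A⁄K]}
    (hx : x ∈ vanishingForms K I) : a * x ∈ vanishingForms K I := by
  induction a using ExteriorAlgebra.induction generalizing x with
  | algebraMap r => rw [← Algebra.smul_def]; exact Submodule.smul_mem _ _ hx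
  | ι w =>
    obtain ⟨y, hy, z, hz, rfl⟩ := Submodule.mem_sup.mp hx
    rw [mul_add]
    refine add_mem (Submodule.mem_sup_left ?_) (Submodule.mem_sup_right ?_)
    · clear hx
      induction hy using Submodule.mul_induction_on' with
      | mem_mul_mem u hu y _ =>
        obtain ⟨u, hu, rfl⟩ := hu
        have h := eq_neg_of_add_eq_zero_left (ExteriorAlgebra.ι_add_mul_swap (R := A) w u)
        rw [← mul_assoc, h, neg_mul, mul_assoc]
        exact neg_mem (Submodule.mul_mem_mul ⟨_, hu, rfl⟩ trivial)
      | add x _ y _ hx hy => rw [mul_add]; exact add_mem hx hy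
    · clear hx
      induction hz using Submodule.smul_induction_on' with
      | smul r hr y _ =>
        rw [mul_smul_comm]
        exact Submodule.smul_mem_smul hr trivial
      | add x _ y _ hx hy => rw [mul_add]; exact add_mem hx hy
  | mul a b ha hb => rw [mul_assoc]; exact ha (hb hx)
  | add a b ha hb => rw [add_mul]; exact add_mem (ha hx) (hb hx)

theorem mul_mem_vanishingForms_right (a : ExteriorAlgebra A Ω[A⁄K])
    {x : ExteriorAlgebra A Ω[A⁄K]} (hx : x ∈ vanishingForms K I) :
    x * a ∈ vanishingForms K I := by
  obtain ⟨y, hy, z, hz, rfl⟩ := Submodule.mem_sup.mp hx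
  rw [add_mul]
  refine add_mem (Submodule.mem_sup_left ?_) (Submodule.mem_sup_right ?_)
  · clear hx
    induction hy using Submodule.mul_induction_on' with
    | mem_mul_mem u hu y _ =>
      rw [mul_assoc]
      exact Submodule.mul_mem_mul hu trivial
    | add x _ y _ hx hy => rw [add_mul]; exact add_mem hx hy
  · clear hx
    induction hz using Submodule.smul_induction_on' with
    | smul r hr y _ =>
      rw [smul_mul_assoc]
      exact Submodule.smul_mem_smul hr trivial
    | add x _ y _ hx hy => rw [add_mul]; exact add_mem hx hy

/-- The two-sided ideal of forms that vanish on the quotient by `I`. -/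
noncomputable def vanishingIdeal (K : Type*) {A : Type*} [CommRing K] [CommRing A] [Algebra K A]
    (I : Ideal A) : Ideal (ExteriorAlgebra A Ω[A⁄K]) where
  toAddSubmonoid := (vanishingForms K I).toAddSubmonoid
  smul_mem' a _ hx := mul_mem_vanishingForms_left I a hx

instance vanishingIdeal_isTwoSided : (vanishingIdeal K I).IsTwoSided :=
  ⟨fun b h => mul_mem_vanishingForms_right I b h⟩

theorem mem_vanishingIdeal {x : ExteriorAlgebra A Ω[A⁄K]} :
    x ∈ vanishingIdeal K I ↔ x ∈ vanishingForms K I := Iff.rfl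

/-- In the quotient by the vanishing ideal, `I` acts as zero and d kills `I`. The quotient is thus
an algebra over `A ⧸ I`, and the two universal properties (Kähler differentials, then exterior
algebra) yield a map back from the forms on `A ⧸ I`. This bounds the kernel of `formsQuotMap` from
above. -/
theorem exists_lift_formsQuotMap :
    ∃ g : ExteriorAlgebra (A ⧸ I) Ω[A ⧸ I⁄K] →+* ExteriorAlgebra A Ω[A⁄K] ⧸ vanishingIdeal K I,
      ∀ x, g (formsQuotMap K I x) = Ideal.Quotient.mk _ x := by
  let Q := ExteriorAlgebra A Ω[A⁄K] ⧸ vanishingIdeal K I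
  have hI : ∀ f ∈ I, algebraMap A Q f = 0 := fun f hf => by
    refine Ideal.Quotient.eq_zero_iff_mem.mpr ?_
    rw [mem_vanishingIdeal, Algebra.algebraMap_eq_smul_one]
    exact Submodule.mem_sup_right (Submodule.smul_mem_smul hf trivial)
  let : Algebra (A ⧸ I) Q := RingHom.toAlgebra' (Ideal.Quotient.lift I (algebraMap A Q) hI) (by
    intro c x
    obtain ⟨c, rfl⟩ := Ideal.Quotient.mk_surjective c
    exact Algebra.commutes c x)
  have : IsScalarTower A (A ⧸ I) Q := IsScalarTower.of_algebraMap_eq (fun _ => rfl)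
  have : IsScalarTower K (A ⧸ I) Q := IsScalarTower.of_algebraMap_eq (fun r => by
    rw [IsScalarTower.algebraMap_apply K A (A ⧸ I), ← IsScalarTower.algebraMap_apply A (A ⧸ I) Q,
      ← IsScalarTower.algebraMap_apply K A Q])
  let π : ExteriorAlgebra A Ω[A⁄K] →ₐ[A] Q := Ideal.Quotient.mkₐ A _
  let d₀ : Derivation K A Q :=
    (π.toLinearMap ∘ₗ ExteriorAlgebra.ι A).compDer (KaehlerDifferential.D K A)
  have hd₀ : ∀ f, d₀ f = π (ExteriorAlgebra.ι A (KaehlerDifferential.D K A f)) := fun _ => rfl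
  have hd : ∀ f ∈ I, d₀ f = 0 := fun f hf => by
    refine Ideal.Quotient.eq_zero_iff_mem.mpr ?_
    rw [mem_vanishingIdeal]
    refine Submodule.mem_sup_left ?_
    rw [← mul_one (ExteriorAlgebra.ι A _)]
    exact Submodule.mul_mem_mul ⟨_, Submodule.subset_span ⟨f, hf, rfl⟩, rfl⟩ trivial
  have hι : ∀ w, π (ExteriorAlgebra.ι A w) = d₀.liftKaehlerDifferential w := fun w =>
    LinearMap.congr_fun (Derivation.liftKaehlerDifferential_unique
      (π.toLinearMap ∘ₗ ExteriorAlgebra.ι A) d₀.liftKaehlerDifferential (by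
        rw [Derivation.liftKaehlerDifferential_comp])) w
  let φ := (d₀.ofQuotient hd).liftKaehlerDifferential
  have hφ : ∀ w, φ (KaehlerDifferential.map K K A (A ⧸ I) w) = π (ExteriorAlgebra.ι A w) := by
    intro w
    have : φ.restrictScalars A ∘ₗ KaehlerDifferential.map K K A (A ⧸ I) =
        d₀.liftKaehlerDifferential := by
      refine Derivation.liftKaehlerDifferential_unique _ _ ?_
      ext f
      simp [φ, Derivation.ofQuotient_mk]
    rw [hι, ← this]
    rfl
  have hs : Function.Surjective (KaehlerDifferential.map K K A (A ⧸ I)) :=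
    KaehlerDifferential.map_surjective_of_surjective K K A (A ⧸ I) Ideal.Quotient.mk_surjective
  let g : ExteriorAlgebra (A ⧸ I) Ω[A ⧸ I⁄K] →ₐ[A ⧸ I] Q := ExteriorAlgebra.lift (A ⧸ I)
    ⟨φ, fun w => by
      obtain ⟨w, rfl⟩ := hs w
      rw [hφ, ← map_mul, ExteriorAlgebra.ι_sq_zero, map_zero]⟩
  have hg : (g.restrictScalars A).comp (formsQuotMap K I) = π := by
    refine ExteriorAlgebra.hom_ext (LinearMap.ext fun w => ?_)
    change g (formsQuotMap K I (ExteriorAlgebra.ι A w)) = π (ExteriorAlgebra.ι A w)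
    rw [formsQuotMap_ι, ExteriorAlgebra.lift_ι_apply, hφ]
  exact ⟨g.toRingHom, fun x => AlgHom.congr_fun hg x⟩

theorem mem_vanishingForms_of_formsQuotMap_eq_zero {x : ExteriorAlgebra A Ω[A⁄K]}
    (hx : formsQuotMap K I x = 0) : x ∈ vanishingForms K I := by
  obtain ⟨g, hg⟩ := exists_lift_formsQuotMap (K := K) I
  rw [← mem_vanishingIdeal, ← Ideal.Quotient.eq_zero_iff_mem, ← hg, hx, map_zero]

theorem mem_dIdealWedge_of_formsQuotMap_eq_zero {l : ℕ} {x : ExteriorAlgebra A Ω[A⁄K]}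
    (hl : x ∈ kaehlerForms K A (l + 1)) (hx : formsQuotMap K I x = 0) :
    x ∈ dIdealWedge K I l := by
  -- Projecting to form degree l + 1 cuts the kernel down to one degree. That degree is positive, so
  -- the summand from `I` is absorbed into `dI ∧ Ω^l`.
  let p := GradedAlgebra.proj (fun i : ℕ => ⋀[A]^i Ω[A⁄K]) (l + 1)
  have hp : vanishingForms K I ≤ (dIdealWedge K I l).comap p := by
    refine sup_le (Submodule.mul_le.mpr ?_) ?_
    · rintro _ ⟨u, hu, rfl⟩ y -
      have h1 : ExteriorAlgebra.ι A u ∈ ⋀[A]^1 Ω[A⁄K] := by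
        rw [ExteriorAlgebra.exteriorPower, pow_one]
        exact ⟨u, rfl⟩
      rw [Submodule.mem_comap, GradedAlgebra.proj_apply, add_comm l 1,
        DirectSum.coe_decompose_mul_add_of_left_mem (fun i : ℕ => ⋀[A]^i Ω[A⁄K]) h1]
      exact Submodule.mul_mem_mul ⟨u, hu, rfl⟩ (SetLike.coe_mem _)
    · refine Submodule.smul_le.mpr fun f hf y _ => ?_
      rw [Submodule.mem_comap, map_smul]
      exact smul_mem_dIdealWedge I hf (SetLike.coe_mem _)
  have h := hp (mem_vanishingForms_of_formsQuotMap_eq_zero I hx)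
  rwa [Submodule.mem_comap, GradedAlgebra.proj_apply,
    DirectSum.decompose_of_mem_same (fun i : ℕ => ⋀[A]^i Ω[A⁄K]) hl] at h

theorem formsQuotMap_eq_zero_of_mem_dIdealWedge {l : ℕ} {x : ExteriorAlgebra A Ω[A⁄K]}
    (hx : x ∈ dIdealWedge K I l) : formsQuotMap K I x = 0 := by
  have h : dIdeal K I ≤ LinearMap.ker (KaehlerDifferential.map K K A (A ⧸ I)) := by
    rw [dIdeal, Submodule.span_le]
    rintro _ ⟨f, hf, rfl⟩
    simp [Ideal.Quotient.eq_zero_iff_mem.mpr hf]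
  have h' : dIdealWedge K I l ≤ LinearMap.ker (formsQuotMap K I).toLinearMap := by
    refine Submodule.mul_le.mpr ?_
    rintro _ ⟨u, hu, rfl⟩ y -
    rw [LinearMap.mem_ker, AlgHom.toLinearMap_apply, map_mul, formsQuotMap_ι,
      LinearMap.mem_ker.mp (h hu), map_zero, zero_mul]
  exact h' hx

end Quotient

theorem pderiv_pderiv_comm {R σ : Type*} [CommRing R] (i j : σ) (f : MvPolynomial σ R) :
    MvPolynomial.pderiv i (MvPolynomial.pderiv j f) =
      MvPolynomial.pderiv j (MvPolynomial.pderiv i f) := by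
  classical
  have h : ⁅MvPolynomial.pderiv (R := R) i, MvPolynomial.pderiv (R := R) j⁆ = 0 := by
    refine MvPolynomial.derivation_ext fun k => ?_
    rw [Derivation.commutator_apply, MvPolynomial.pderiv_X, MvPolynomial.pderiv_X]
    simp only [Pi.single_apply]
    split_ifs <;> simp
  have h' := Derivation.congr_fun h f
  rwa [Derivation.commutator_apply, Derivation.zero_apply, sub_eq_zero] at h'

/-! ### Polynomial forms: monomial basis, contraction, exterior and Lie derivatives -/

section PolyForms

open Module

/-- The algebra of differential forms of the polynomial ring in `n` variables. -/
abbrev PolyForms (K : Type*) [Field K] (n : ℕ) :=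
  ExteriorAlgebra (MvPolynomial (Fin n) K) Ω[MvPolynomial (Fin n) K⁄K]

variable (K : Type*) [Field K] {n : ℕ}

/-- The one-form `dX_i`. -/
noncomputable def dX (i : Fin n) : PolyForms K n :=
  ExteriorAlgebra.ι _ (KaehlerDifferential.D K (MvPolynomial (Fin n) K) (MvPolynomial.X i))

theorem dX_mul_self (i : Fin n) : dX K i * dX K i = 0 := ExteriorAlgebra.ι_sq_zero _

theorem dX_mul_swap (i j : Fin n) : dX K i * dX K j = -(dX K j * dX K i) :=
  eq_neg_of_add_eq_zero_left (ExteriorAlgebra.ι_add_mul_swap _ _)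

/-- The product of the `dX_i` along a list of indices. -/
noncomputable def dXProd (l : List (Fin n)) : PolyForms K n := (l.map (dX K)).prod

@[simp] theorem dXProd_nil : dXProd K ([] : List (Fin n)) = 1 := rfl

@[simp] theorem dXProd_cons (i : Fin n) (l : List (Fin n)) :
    dXProd K (i :: l) = dX K i * dXProd K l := by simp [dXProd]

-- The sign can stay undetermined: only spans and vanishing are at stake.
variable {K} in
theorem dXProd_perm {l l' : List (Fin n)} (h : l.Perm l') :
    dXProd K l = dXProd K l' ∨ dXProd K l = -dXProd K l' := by
  induction h with
  | nil => exact Or.inl rfl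
  | cons i _ ih =>
    rcases ih with ih | ih <;> simp [ih]
  | swap i j l =>
    right
    rw [dXProd_cons, dXProd_cons, dXProd_cons, dXProd_cons, ← mul_assoc, ← mul_assoc,
      dX_mul_swap K j i, neg_mul]
  | trans _ _ ih₁ ih₂ =>
    rcases ih₁ with h₁ | h₁ <;> rcases ih₂ with h₂ | h₂ <;> simp [h₁, h₂]

theorem dX_mul_dXProd_of_mem {i : Fin n} {l : List (Fin n)} (h : i ∈ l) :
    dX K i * dXProd K l = 0 := by
  rcases dXProd_perm (K := K) (List.perm_cons_erase h) with h | h <;>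
    rw [h, dXProd_cons] <;> simp [← mul_assoc, dX_mul_self]

theorem dXProd_of_not_nodup {l : List (Fin n)} (h : ¬ l.Nodup) : dXProd K l = 0 := by
  induction l with
  | nil => simp at h
  | cons i l ih =>
    rw [dXProd_cons]
    by_cases hl : l.Nodup
    · refine dX_mul_dXProd_of_mem K ?_
      by_contra hi
      exact h (List.nodup_cons.mpr ⟨hi, hl⟩)
    · rw [ih hl, mul_zero]

/-- The basis of the algebra of forms given by the products of the `dX_i`. -/
noncomputable def formsBasis (K : Type*) [Field K] (n : ℕ) :
    Basis (Finset (Fin n)) (MvPolynomial (Fin n) K) (PolyForms K n) :=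
  (KaehlerDifferential.mvPolynomialBasis K (Fin n)).ExteriorAlgebra

theorem exists_formsBasis_eq_dXProd (s : Finset (Fin n)) :
    ∃ l : List (Fin n), l.Nodup ∧ l.toFinset = s ∧ formsBasis K n s = dXProd K l := by
  let f := Set.powersetCard.ofFinEmbEquiv.symm (Set.powersetCard.prodEquiv.symm s).2
  refine ⟨List.ofFn f, List.nodup_ofFn.mpr f.injective, ?_, ?_⟩
  · ext i
    rw [List.mem_toFinset, List.mem_ofFn', Set.powersetCard.mem_range_ofFinEmbEquiv_symm_iff_mem]
    rfl
  · have h : formsBasis K n s = ExteriorAlgebra.ιMulti _ s.card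
        (KaehlerDifferential.mvPolynomialBasis K (Fin n) ∘ f) :=
      ExteriorAlgebra.basis_apply _ s
    rw [h, ExteriorAlgebra.ιMulti_apply, dXProd, List.map_ofFn]
    congr 2
    ext i
    simp [dX]

variable {K} in
theorem dXProd_mem_span (l : List (Fin n)) :
    dXProd K l ∈ Submodule.span K (formsBasis K n '' {s | s.card = l.length}) := by
  by_cases h : l.Nodup
  · obtain ⟨l', hl', hs, h'⟩ := exists_formsBasis_eq_dXProd K l.toFinset
    have hm : formsBasis K n l.toFinset ∈
        Submodule.span K (formsBasis K n '' {s | s.card = l.length}) :=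
      Submodule.subset_span ⟨_, List.toFinset_card_of_nodup h, rfl⟩
    rw [h'] at hm
    have hp : l.Perm l' := by
      rw [List.perm_ext_iff_of_nodup h hl']
      intro a
      rw [← List.mem_toFinset, ← hs, List.mem_toFinset]
    rcases dXProd_perm (K := K) hp with h | h
    · rwa [h]
    · rw [h]; exact neg_mem hm
  · rw [dXProd_of_not_nodup K h]; exact zero_mem _

/-- Forms of degree `m` with constant coefficients. -/
noncomputable def constForms (K : Type*) [Field K] (n m : ℕ) : Submodule K (PolyForms K n) :=
  Submodule.span K (formsBasis K n '' {s | s.card = m})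

theorem formsBasis_mem_constForms {s : Finset (Fin n)} {m : ℕ} (h : s.card = m) :
    formsBasis K n s ∈ constForms K n m := Submodule.subset_span ⟨s, h, rfl⟩

variable {K} in
theorem dXProd_mem_constForms {l : List (Fin n)} {m : ℕ} (h : l.length = m) :
    dXProd K l ∈ constForms K n m := by
  subst h; exact dXProd_mem_span l

variable {K} in
theorem constForms_induction {m : ℕ} {p : PolyForms K n → Prop}
    (hl : ∀ l : List (Fin n), l.length = m → p (dXProd K l)) (h0 : p 0)
    (hadd : ∀ x y, p x → p y → p (x + y)) (hsmul : ∀ (c : K) x, p x → p (c • x))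
    {x : PolyForms K n} (hx : x ∈ constForms K n m) : p x := by
  refine Submodule.span_induction ?_ h0 (fun x y _ _ => hadd x y) (fun c x _ => hsmul c x) hx
  rintro _ ⟨s, hs, rfl⟩
  obtain ⟨l, hl', hs', h⟩ := exists_formsBasis_eq_dXProd K s
  rw [h]
  refine hl l ?_
  rw [← List.toFinset_card_of_nodup hl', hs']
  exact hs

/-- Contraction with the vector field `∂/∂X_i`. -/
noncomputable def contr (i : Fin n) : PolyForms K n →ₗ[MvPolynomial (Fin n) K] PolyForms K n :=
  CliffordAlgebra.contractLeft ((KaehlerDifferential.mvPolynomialBasis K (Fin n)).coord i)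

theorem contr_one (i : Fin n) : contr K i 1 = 0 := CliffordAlgebra.contractLeft_one _ _

theorem contr_dX_mul (i j : Fin n) (x : PolyForms K n) :
    contr K i (dX K j * x) = (if i = j then x else 0) - dX K j * contr K i x := by
  refine (CliffordAlgebra.contractLeft_ι_mul _ _ _).trans ?_
  congr 1
  rw [Basis.coord_apply, KaehlerDifferential.mvPolynomialBasis_repr_D_X]
  by_cases h : i = j
  · subst h; simp
  · simp [h]

variable {K} in
theorem dX_mul_mem_constForms {m : ℕ} (i : Fin n) {x : PolyForms K n}
    (hx : x ∈ constForms K n m) : dX K i * x ∈ constForms K n (m + 1) := by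
  refine constForms_induction (p := fun x => dX K i * x ∈ constForms K n (m + 1))
    (fun l hl => ?_) (by simp) (fun x y hx hy => ?_) (fun c x hx => ?_) hx
  · rw [← dXProd_cons]
    exact dXProd_mem_constForms (by simp [hl])
  · rw [mul_add]; exact add_mem hx hy
  · rw [mul_smul_comm]; exact Submodule.smul_mem _ _ hx

theorem contr_dXProd_mem (i : Fin n) (l : List (Fin n)) :
    contr K i (dXProd K l) ∈ constForms K n (l.length - 1) := by
  induction l with
  | nil => simp [contr_one]
  | cons j l ih =>
    rw [dXProd_cons, contr_dX_mul]
    refine sub_mem ?_ ?_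
    · split_ifs
      · exact dXProd_mem_constForms (by simp)
      · exact zero_mem _
    · rcases l with - | ⟨j', l⟩
      · simp [contr_one]
      · exact dX_mul_mem_constForms _ ih

variable {K} in
theorem contr_mem_constForms {m : ℕ} (i : Fin n) {x : PolyForms K n}
    (hx : x ∈ constForms K n m) : contr K i x ∈ constForms K n (m - 1) := by
  refine constForms_induction (p := fun x => contr K i x ∈ constForms K n (m - 1))
    (fun l hl => ?_) (by simp) (fun x y hx hy => ?_) (fun c x hx => ?_) hx
  · rw [← hl]; exact contr_dXProd_mem K i l
  · rw [map_add]; exact add_mem hx hy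
  · rw [LinearMap.map_smul_of_tower]; exact Submodule.smul_mem _ _ hx

/-- Contracting with ∂/∂X_i and then multiplying by dX_i projects onto the products containing dX_i;
this is the form part of the weight in direction i. -/
theorem dX_mul_contr_dXProd (i : Fin n) (l : List (Fin n)) (h : l.Nodup) :
    dX K i * contr K i (dXProd K l) = if i ∈ l then dXProd K l else 0 := by
  induction l with
  | nil => simp [contr_one]
  | cons j l ih =>
    rw [List.nodup_cons] at h
    rw [dXProd_cons, contr_dX_mul]
    by_cases hij : i = j
    · subst hij
      simp [mul_sub, ← mul_assoc, dX_mul_self]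
    · have := ih h.2
      rw [if_neg hij, zero_sub, mul_neg, ← mul_assoc, dX_mul_swap K i j, neg_mul, neg_neg,
        mul_assoc, this]
      simp [hij]

theorem dX_mul_contr_formsBasis (i : Fin n) (s : Finset (Fin n)) :
    dX K i * contr K i (formsBasis K n s) = if i ∈ s then formsBasis K n s else 0 := by
  obtain ⟨l, hl, rfl, h⟩ := exists_formsBasis_eq_dXProd K s
  simp [h, dX_mul_contr_dXProd K i l hl]

/-- The basis over `K` of the algebra of forms given by the products of the `dX_i` with monomial
coefficients. -/
noncomputable def monoBasis (K : Type*) [Field K] (n : ℕ) :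
    Basis ((Fin n →₀ ℕ) × Finset (Fin n)) K (PolyForms K n) :=
  (MvPolynomial.basisMonomials (Fin n) K).smulTower (formsBasis K n)

theorem monoBasis_apply (p : (Fin n →₀ ℕ) × Finset (Fin n)) :
    monoBasis K n p = MvPolynomial.monomial p.1 (1 : K) • formsBasis K n p.2 := by
  simp [monoBasis, Basis.smulTower_apply]

/-- The partial derivative with respect to `X_i`, acting on the coefficients of forms. -/
noncomputable def partialForms (i : Fin n) : PolyForms K n →ₗ[K] PolyForms K n :=
  (monoBasis K n).constr K fun p =>
    MvPolynomial.pderiv i (MvPolynomial.monomial p.1 (1 : K)) • formsBasis K n p.2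

variable {K} in
theorem partialForms_smul (i : Fin n) (f : MvPolynomial (Fin n) K) {m : ℕ} {x : PolyForms K n}
    (hx : x ∈ constForms K n m) :
    partialForms K i (f • x) = MvPolynomial.pderiv i f • x := by
  induction hx using Submodule.span_induction with
  | mem x hx =>
    obtain ⟨s, -, rfl⟩ := hx
    induction f using MvPolynomial.induction_on' with
    | add p q hp hq => rw [add_smul, map_add, hp, hq, map_add, add_smul]
    | monomial u a =>
      have : MvPolynomial.monomial u a = a • MvPolynomial.monomial u (1 : K) := by
        simp [MvPolynomial.smul_monomial]
      rw [this, smul_assoc, map_smul, ← monoBasis_apply K (u, s), partialForms, Basis.constr_basis,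
        Derivation.map_smul, smul_assoc]
  | zero => simp
  | add x y _ _ hx hy => rw [smul_add, map_add, hx, hy, smul_add]
  | smul c x _ hx => rw [smul_comm, map_smul, hx, smul_comm]

/-- The exterior derivative on polynomial forms. -/
noncomputable def formsDeriv (K : Type*) [Field K] (n : ℕ) : PolyForms K n →ₗ[K] PolyForms K n :=
  ∑ i, LinearMap.mulLeft K (dX K i) ∘ₗ partialForms K i

variable {K} in
theorem formsDeriv_smul (f : MvPolynomial (Fin n) K) {m : ℕ} {x : PolyForms K n}
    (hx : x ∈ constForms K n m) :
    formsDeriv K n (f • x) = ∑ i, MvPolynomial.pderiv i f • (dX K i * x) := by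
  simp [formsDeriv, partialForms_smul _ _ hx]

variable {K} in
theorem polyForms_linearMap_ext {V : Type*} [AddCommGroup V] [Module K V]
    {f g : PolyForms K n →ₗ[K] V}
    (h : ∀ (u : Fin n →₀ ℕ) (s : Finset (Fin n)),
      f (MvPolynomial.monomial u (1 : K) • formsBasis K n s) =
        g (MvPolynomial.monomial u (1 : K) • formsBasis K n s)) : f = g := by
  refine (monoBasis K n).ext fun p => ?_
  rw [monoBasis_apply]
  exact h _ _

theorem formsDeriv_comp_self : formsDeriv K n ∘ₗ formsDeriv K n = 0 := by
  refine polyForms_linearMap_ext fun u s => ?_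
  have hs := formsBasis_mem_constForms K (s := s) rfl
  rw [LinearMap.comp_apply, formsDeriv_smul _ hs, map_sum, LinearMap.zero_apply]
  simp_rw [formsDeriv_smul _ (dX_mul_mem_constForms _ hs)]
  rw [← Finset.sum_product']
  -- The terms (i, j) and (j, i) cancel, second partials being symmetric and wedge products
  -- antisymmetric.
  refine Finset.sum_involution (fun p _ => p.swap) ?_ ?_ (by simp) (by simp)
  · rintro ⟨i, j⟩ -
    simp only [Prod.swap]
    rw [← mul_assoc, ← mul_assoc, dX_mul_swap K i j, neg_mul, smul_neg,
      pderiv_pderiv_comm i j, add_neg_cancel]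
  · rintro ⟨i, j⟩ - h hij
    obtain rfl : j = i := congrArg Prod.fst hij
    exact h (by simp [← mul_assoc, dX_mul_self])

theorem formsDeriv_formsDeriv (x : PolyForms K n) : formsDeriv K n (formsDeriv K n x) = 0 :=
  LinearMap.congr_fun (formsDeriv_comp_self K) x

/-- Contraction with the vector field `X_i ∂/∂X_i`. -/
noncomputable def eulerContr (i : Fin n) : PolyForms K n →ₗ[K] PolyForms K n :=
  ((MvPolynomial.X i : MvPolynomial (Fin n) K) • contr K i).restrictScalars K

/-- The Lie derivative along the vector field `X_i ∂/∂X_i`. -/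
noncomputable def lieDeriv (i : Fin n) : Module.End K (PolyForms K n) :=
  formsDeriv K n ∘ₗ eulerContr K i + eulerContr K i ∘ₗ formsDeriv K n

theorem lieDeriv_apply (i : Fin n) (x : PolyForms K n) :
    lieDeriv K i x = formsDeriv K n (eulerContr K i x) + eulerContr K i (formsDeriv K n x) := rfl

theorem eulerContr_apply (i : Fin n) (x : PolyForms K n) :
    eulerContr K i x = (MvPolynomial.X i : MvPolynomial (Fin n) K) • contr K i x := rfl

variable {K} in
theorem lieDeriv_smul (i : Fin n) (f : MvPolynomial (Fin n) K) {m : ℕ} {x : PolyForms K n}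
    (hx : x ∈ constForms K n m) :
    lieDeriv K i (f • x) =
      f • (dX K i * contr K i x) + (MvPolynomial.X i * MvPolynomial.pderiv i f) • x := by
  rw [lieDeriv_apply, eulerContr_apply, eulerContr_apply, map_smul (contr K i),
    smul_smul,
    formsDeriv_smul _ (contr_mem_constForms i hx), formsDeriv_smul _ hx, map_sum, Finset.smul_sum,
    ← Finset.sum_add_distrib]
  -- For j ≠ i the two terms cancel, as contraction anticommutes with dX_j; for j = i the Leibniz
  -- rule and the contraction leave exactly the two summands of the weight.
  have : ∀ j, MvPolynomial.pderiv j (MvPolynomial.X i * f) • (dX K j * contr K i x) +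
      (MvPolynomial.X i : MvPolynomial (Fin n) K) •
        contr K i (MvPolynomial.pderiv j f • (dX K j * x)) =
      if i = j then f • (dX K i * contr K i x) + (MvPolynomial.X i * MvPolynomial.pderiv i f) • x
      else 0 := by
    intro j
    rw [map_smul (contr K i), contr_dX_mul, Derivation.leibniz, MvPolynomial.pderiv_X]
    by_cases hij : i = j
    · subst hij
      simp only [if_true, Pi.single_eq_same, smul_eq_mul, mul_one]
      rw [add_smul, smul_sub, smul_sub, smul_smul, smul_smul]
      abel
    · simp [hij, mul_smul]
  simp_rw [this]
  simp

/-- Monomial forms are common eigenvectors; the weight counts X_i in the coefficient and dX_i in the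
form. -/
theorem lieDeriv_monoBasis (i : Fin n) (p : (Fin n →₀ ℕ) × Finset (Fin n)) :
    lieDeriv K i (monoBasis K n p) =
      ((p.1 i + if i ∈ p.2 then 1 else 0 : ℕ) : K) • monoBasis K n p := by
  rw [monoBasis_apply, lieDeriv_smul i _ (formsBasis_mem_constForms K (s := p.2) rfl),
    dX_mul_contr_formsBasis, MvPolynomial.X_mul_pderiv_monomial, smul_assoc]
  split_ifs
  · rw [add_comm, Nat.cast_add, add_smul, Nat.cast_one, one_smul, Nat.cast_smul_eq_nsmul]
  · rw [smul_zero, zero_add, add_zero, Nat.cast_smul_eq_nsmul]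

theorem lieDeriv_formsDeriv (i : Fin n) (x : PolyForms K n) :
    formsDeriv K n (lieDeriv K i x) = lieDeriv K i (formsDeriv K n x) := by
  simp [lieDeriv_apply, formsDeriv_formsDeriv]

end PolyForms

/-! ### Poincaré lemma and the rank of d in a fixed coefficient degree -/

section FormsSpan

open Module MvPolynomial

/-- Forms of degree `m` whose coefficients only involve monomials with degree in `P`. -/
noncomputable def formsSpan (K : Type*) [Field K] (n : ℕ) (P : Set ℕ) (m : ℕ) :
    Submodule K (PolyForms K n) :=
  Submodule.span K (monoBasis K n '' {p | p.1.degree ∈ P ∧ p.2.card = m})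

variable {K : Type*} [Field K] {n : ℕ} {P : Set ℕ} {m : ℕ}

theorem formsSpan_le {N : Submodule K (PolyForms K n)}
    (h : ∀ (u : Fin n →₀ ℕ) (s : Finset (Fin n)), u.degree ∈ P → s.card = m →
      monomial u (1 : K) • formsBasis K n s ∈ N) : formsSpan K n P m ≤ N := by
  refine Submodule.span_le.mpr ?_
  rintro _ ⟨p, ⟨hp₁, hp₂⟩, rfl⟩
  rw [monoBasis_apply]
  exact h _ _ hp₁ hp₂

theorem formsSpan_mono {P' : Set ℕ} (h : P ⊆ P') : formsSpan K n P m ≤ formsSpan K n P' m :=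
  Submodule.span_mono (Set.image_mono fun _ hp => ⟨h hp.1, hp.2⟩)

theorem monomial_smul_mem_formsSpan {u : Fin n →₀ ℕ} (hu : u.degree ∈ P) (a : K)
    {x : PolyForms K n} (hx : x ∈ constForms K n m) : monomial u a • x ∈ formsSpan K n P m := by
  have : monomial u a = a • monomial u (1 : K) := by simp [smul_monomial]
  rw [this, smul_assoc]
  refine Submodule.smul_mem _ _ ?_
  induction hx using Submodule.span_induction with
  | mem x hx =>
    obtain ⟨s, hs, rfl⟩ := hx
    exact Submodule.subset_span ⟨(u, s), ⟨hu, hs⟩, monoBasis_apply K _⟩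
  | zero => simp
  | add x y _ _ hx hy => rw [smul_add]; exact add_mem hx hy
  | smul c x _ hx => rw [smul_comm]; exact Submodule.smul_mem _ _ hx

theorem smul_mem_formsSpan {f : MvPolynomial (Fin n) K} (hf : ∀ u ∈ f.support, u.degree ∈ P)
    {x : PolyForms K n} (hx : x ∈ constForms K n m) : f • x ∈ formsSpan K n P m := by
  rw [f.as_sum, Finset.sum_smul]
  exact Submodule.sum_mem _ fun u hu => monomial_smul_mem_formsSpan (hf u hu) _ hx

theorem pderiv_monomial_smul_mem_formsSpan (i : Fin n) {u : Fin n →₀ ℕ} {j : ℕ}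
    (hu : u.degree = j + 1) {x : PolyForms K n} (hx : x ∈ constForms K n m) :
    pderiv i (monomial u (1 : K)) • x ∈ formsSpan K n {j} m := by
  rw [pderiv_monomial]
  by_cases h : u i = 0
  · simp [h]
  · refine monomial_smul_mem_formsSpan ?_ _ hx
    have h1 : u - Finsupp.single i 1 + Finsupp.single i 1 = u :=
      tsub_add_cancel_of_le (by simpa [Nat.one_le_iff_ne_zero] using h)
    have h2 := congrArg Finsupp.degree h1
    rw [map_add, Finsupp.degree_single, hu] at h2
    exact Nat.succ_injective h2

theorem map_formsDeriv_formsSpan_le (j : ℕ) :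
    (formsSpan K n {j + 1} m).map (formsDeriv K n) ≤ formsSpan K n {j} (m + 1) := by
  refine Submodule.map_le_iff_le_comap.mpr (formsSpan_le fun u s hu hs => ?_)
  have hs' := formsBasis_mem_constForms K hs
  rw [Submodule.mem_comap, formsDeriv_smul _ hs']
  exact Submodule.sum_mem _ fun i _ =>
    pderiv_monomial_smul_mem_formsSpan i hu (dX_mul_mem_constForms i hs')

theorem map_formsDeriv_formsSpan_zero : (formsSpan K n {0} m).map (formsDeriv K n) = ⊥ := by
  refine eq_bot_iff.mpr (Submodule.map_le_iff_le_comap.mpr (formsSpan_le fun u s hu hs => ?_))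
  rw [Submodule.mem_comap, formsDeriv_smul _ (formsBasis_mem_constForms K hs),
    (Finsupp.degree_eq_zero_iff u).mp hu]
  simp

theorem map_eulerContr_formsSpan_le (i : Fin n) (j : ℕ) :
    (formsSpan K n {j} (m + 1)).map (eulerContr K i) ≤ formsSpan K n {j + 1} m := by
  refine Submodule.map_le_iff_le_comap.mpr (formsSpan_le fun u s hu hs => ?_)
  have h : eulerContr K i (monomial u (1 : K) • formsBasis K n s) =
      monomial (Finsupp.single i 1 + u) (1 : K) • contr K i (formsBasis K n s) := by
    rw [eulerContr_apply, map_smul (contr K i), smul_smul, X, monomial_mul, one_mul]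
  rw [Submodule.mem_comap, h]
  have hc : contr K i (formsBasis K n s) ∈ constForms K n (m + 1 - 1) :=
    contr_mem_constForms i (formsBasis_mem_constForms K hs)
  rw [Nat.add_sub_cancel] at hc
  refine monomial_smul_mem_formsSpan ?_ _ hc
  rw [Set.mem_singleton_iff] at hu ⊢
  rw [map_add, Finsupp.degree_single, hu, add_comm]

theorem map_lieDeriv_formsSpan_le (i : Fin n) :
    (formsSpan K n P m).map (lieDeriv K i) ≤ formsSpan K n P m := by
  refine Submodule.map_le_iff_le_comap.mpr (Submodule.span_le.mpr ?_)
  rintro _ ⟨p, hp, rfl⟩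
  rw [SetLike.mem_coe, Submodule.mem_comap, lieDeriv_monoBasis]
  exact Submodule.smul_mem _ _ (Submodule.subset_span ⟨p, hp, rfl⟩)

theorem lieDeriv_prod_monoBasis (L : List (Fin n × ℕ)) (p : (Fin n →₀ ℕ) × Finset (Fin n)) :
    (L.map fun q => lieDeriv K q.1 - (q.2 : K) • (1 : End K (PolyForms K n))).prod
        (monoBasis K n p) =
      (L.map fun q => ((p.1 q.1 + if q.1 ∈ p.2 then 1 else 0 : ℕ) : K) - (q.2 : K)).prod •
        monoBasis K n p := by
  induction L with
  | nil => simp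
  | cons q L ih =>
    rw [List.map_cons, List.prod_cons, Module.End.mul_apply, ih, map_smul, LinearMap.sub_apply,
      lieDeriv_monoBasis, LinearMap.smul_apply, Module.End.one_apply, ← sub_smul, smul_smul,
      List.map_cons, List.prod_cons, mul_comm]

/-- By Cartan's formula each Lie derivative sends closed forms to exact ones, so modulo exact forms
`lieDeriv K i - c` acts on closed forms as the scalar -c. The product of these operators over all i
and 1 ≤ c ≤ j + 1 is thus an invertible scalar modulo exact forms, yet it annihilates all the forms
considered. -/
theorem mem_map_formsDeriv_of_formsDeriv_eq_zero {j : ℕ}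
    (hj : ∀ c : ℕ, 1 ≤ c → c ≤ j + 1 → (c : K) ≠ 0)
    {x : PolyForms K n} (hx : x ∈ formsSpan K n {j} (m + 1)) (hd : formsDeriv K n x = 0) :
    x ∈ (formsSpan K n {j + 1} m).map (formsDeriv K n) := by
  set B := (formsSpan K n {j + 1} m).map (formsDeriv K n)
  let Z := formsSpan K n {j} (m + 1) ⊓ LinearMap.ker (formsDeriv K n)
  let F : Fin n × ℕ → End K (PolyForms K n) := fun q => lieDeriv K q.1 - (q.2 : K) • 1
  have hN : ∀ i, ∀ z ∈ Z, lieDeriv K i z ∈ Z := fun i z hz =>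
    ⟨map_lieDeriv_formsSpan_le i ⟨z, hz.1, rfl⟩, by
      rw [SetLike.mem_coe, LinearMap.mem_ker, lieDeriv_formsDeriv,
        LinearMap.mem_ker.mp hz.2, map_zero]⟩
  have hB : ∀ i, ∀ z ∈ Z, lieDeriv K i z ∈ B := fun i z hz => by
    rw [lieDeriv_apply, LinearMap.mem_ker.mp hz.2, map_zero, add_zero]
    exact ⟨_, map_eulerContr_formsSpan_le i j ⟨z, hz.1, rfl⟩, rfl⟩
  have hZ : ∀ L : List (Fin n × ℕ), ∀ z ∈ Z, (L.map F).prod z ∈ Z := by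
    intro L z hz
    induction L with
    | nil => exact hz
    | cons q L ih =>
      rw [List.map_cons, List.prod_cons, Module.End.mul_apply]
      exact sub_mem (hN _ _ ih) (Submodule.smul_mem _ _ ih)
  have key : ∀ L : List (Fin n × ℕ), (∀ q ∈ L, (q.2 : K) ≠ 0) → ∀ z ∈ Z,
      (L.map F).prod z ∈ B → z ∈ B := by
    intro L hL z hz h
    induction L with
    | nil => exact h
    | cons q L ih =>
      refine ih (fun q hq => hL q (List.mem_cons_of_mem _ hq)) ?_
      rw [List.map_cons, List.prod_cons, Module.End.mul_apply] at h
      have h' := sub_mem (hB q.1 _ (hZ L z hz)) h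
      rw [LinearMap.sub_apply, sub_sub_cancel] at h'
      exact (Submodule.smul_mem_iff _ (hL q List.mem_cons_self)).mp h'
  let L : List (Fin n × ℕ) := (Finset.univ ×ˢ Finset.Icc 1 (j + 1)).toList
  refine key L (fun q hq => ?_) x ⟨hx, hd⟩ ?_
  · simp only [L, Finset.mem_toList, Finset.mem_product, Finset.mem_Icc] at hq
    exact hj _ hq.2.1 hq.2.2
  · have h0 : formsSpan K n {j} (m + 1) ≤ LinearMap.ker (L.map F).prod := by
      refine Submodule.span_le.mpr ?_
      rintro _ ⟨p, ⟨hp₁, hp₂⟩, rfl⟩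
      rw [SetLike.mem_coe, LinearMap.mem_ker, lieDeriv_prod_monoBasis]
      -- Positive form degree provides some dX_i; then the weight in direction i is `p.1 i + 1 ≤ j +
      -- 1`, so one factor of the product is zero.
      obtain ⟨i, hi⟩ : p.2.Nonempty := by
        rw [← Finset.card_pos, hp₂]; exact Nat.succ_pos m
      have hle : p.1 i ≤ j := by
        rw [← (hp₁ : p.1.degree = j)]
        exact Finsupp.le_degree i p.1
      rw [List.prod_eq_zero, zero_smul]
      refine List.mem_map.mpr ⟨(i, p.1 i + 1), ?_, ?_⟩
      · simp [L, hle]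
      · simp [hi]
    rw [LinearMap.mem_ker.mp (h0 hx)]
    exact zero_mem _

theorem formsSpan_eq_span_finset (t : Finset ((Fin n →₀ ℕ) × Finset (Fin n)))
    (ht : ∀ p, p ∈ t ↔ p.1.degree ∈ P ∧ p.2.card = m) :
    FiniteDimensional K (formsSpan K n P m) ∧ finrank K (formsSpan K n P m) = t.card := by
  have h : formsSpan K n P m = Submodule.span K (Set.range fun p : t => monoBasis K n p) := by
    have h' : {p : (Fin n →₀ ℕ) × Finset (Fin n) | p.1.degree ∈ P ∧ p.2.card = m} = t :=
      Set.ext fun p => (ht p).symm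
    rw [formsSpan, h', Set.image_eq_range]
    rfl
  rw [h]
  refine ⟨FiniteDimensional.span_of_finite K (Set.finite_range _), ?_⟩
  refine (finrank_span_eq_card ((monoBasis K n).linearIndependent.comp (fun p : t => p.1)
    Subtype.val_injective)).trans ?_
  simp

theorem finrank_formsSpan_singleton (j : ℕ) :
    FiniteDimensional K (formsSpan K n {j} m) ∧
      finrank K (formsSpan K n {j} m) = n.choose m * n.multichoose j := by
  have := formsSpan_eq_span_finset (K := K) (n := n) (P := {j}) (m := m)
    (Finset.univ.finsuppAntidiag j ×ˢ Finset.univ.powersetCard m) (fun p => by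
      simp [Finset.mem_finsuppAntidiag, Finsupp.degree_eq_sum])
  rw [Finset.card_product, Finset.card_finsuppAntidiag_nat_eq_multichoose,
    Finset.card_powersetCard, Finset.card_univ, Fintype.card_fin, mul_comm] at this
  exact this

theorem sum_range_multichoose (n j : ℕ) :
    ∑ i ∈ Finset.range (j + 1), n.multichoose i = (n + j).choose n := by
  induction j with
  | zero => simp
  | succ j ih =>
    rw [Finset.sum_range_succ, ih, Nat.multichoose_eq]
    rcases n with - | n
    · simp
    · rw [show n + 1 + (j + 1) - 1 = n + 1 + j by omega, ← add_assoc (n + 1) j 1,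
        Nat.choose_succ_succ (n + 1 + j) n, add_comm, add_left_inj]
      refine Nat.choose_symm_of_eq_add ?_
      omega

theorem finrank_formsSpan_Iic (j : ℕ) :
    FiniteDimensional K (formsSpan K n (Set.Iic j) m) ∧
      finrank K (formsSpan K n (Set.Iic j) m) = n.choose m * (n + j).choose n := by
  have := formsSpan_eq_span_finset (K := K) (n := n) (P := Set.Iic j) (m := m)
    (((Finset.range (j + 1)).biUnion fun i => (Finset.univ : Finset (Fin n)).finsuppAntidiag i) ×ˢ
      Finset.univ.powersetCard m) (fun p => by
      simp [Finset.mem_finsuppAntidiag, Finsupp.degree_eq_sum])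
  rw [Finset.card_product, Finset.card_biUnion, Finset.card_powersetCard, Finset.card_univ,
    Fintype.card_fin, mul_comm] at this
  · simp_rw [Finset.card_finsuppAntidiag_nat_eq_multichoose, Finset.card_univ, Fintype.card_fin,
      sum_range_multichoose] at this
    exact this
  · intro a _ b _ hab
    rw [Function.onFun, Finset.disjoint_left]
    intro u hu hu'
    rw [Finset.mem_finsuppAntidiag] at hu hu'
    exact hab (hu.1.symm.trans hu'.1)

/-- Rank-nullity for d on (m + 1)-forms with coefficients of degree j, the kernel being the exact
forms by the Poincaré lemma. -/
theorem finrank_map_formsDeriv_add {j : ℕ} (hj : ∀ c : ℕ, 1 ≤ c → c ≤ j + 1 → (c : K) ≠ 0) :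
    finrank K ((formsSpan K n {j + 1} m).map (formsDeriv K n)) +
      finrank K ((formsSpan K n {j} (m + 1)).map (formsDeriv K n)) =
        n.choose (m + 1) * n.multichoose j := by
  obtain ⟨hfin, hrank⟩ := finrank_formsSpan_singleton (K := K) (n := n) (m := m + 1) j
  rw [← hrank, ← LinearMap.finrank_range_add_finrank_ker
    ((formsDeriv K n).domRestrict (formsSpan K n {j} (m + 1))), LinearMap.range_domRestrict,
    add_comm]
  congr 1
  have : (formsSpan K n {j + 1} m).map (formsDeriv K n) =
      (LinearMap.ker ((formsDeriv K n).domRestrict (formsSpan K n {j} (m + 1)))).map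
        (formsSpan K n {j} (m + 1)).subtype := by
    ext x
    constructor
    · intro hx
      refine ⟨⟨x, map_formsDeriv_formsSpan_le j hx⟩, ?_, rfl⟩
      obtain ⟨y, -, rfl⟩ := hx
      exact formsDeriv_formsDeriv K y
    · rintro ⟨⟨x, hx⟩, hx', rfl⟩
      exact mem_map_formsDeriv_of_formsDeriv_eq_zero hj hx hx'
  rw [this]
  exact LinearEquiv.finrank_eq
    (Submodule.equivMapOfInjective _ (Submodule.injective_subtype _) _).symm

/-- After Pascal's rule, trinomial revision matches the left side with the two parts of Pascal's
rule for the first binomial on the right. The case n = 0 is apart because of the shift by one in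
`multichoose`. -/
theorem choose_mul_choose_add (n m i : ℕ) :
    (m + i + 1).choose m * (n + i + 1).choose (m + i + 2) +
      (m + 1 + i).choose (m + 1) * (n + i).choose (m + i + 2) =
        n.choose (m + 1) * n.multichoose (i + 1) := by
  rcases n with - | n
  · rw [Nat.choose_eq_zero_of_lt (show 0 + i + 1 < m + i + 2 by omega),
      Nat.choose_eq_zero_of_lt (show 0 + i < m + i + 2 by omega)]
    simp
  · have h₁ : (n + 1 + i).choose (m + i + 1) * (m + i + 1).choose m =
        (n + 1 + i).choose (i + 1) * n.choose m := by
      rw [Nat.choose_symm_of_eq_add (show m + i + 1 = m + (i + 1) by omega),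
        Nat.choose_mul (by omega), show n + 1 + i - (i + 1) = n by omega,
        show m + i + 1 - (i + 1) = m by omega]
    have h₂ : (n + 1 + i).choose (m + i + 2) * (m + i + 2).choose (m + 1) =
        (n + 1 + i).choose (i + 1) * n.choose (m + 1) := by
      rw [Nat.choose_symm_of_eq_add (show m + i + 2 = m + 1 + (i + 1) by omega),
        Nat.choose_mul (by omega), show n + 1 + i - (i + 1) = n by omega,
        show m + i + 2 - (i + 1) = m + 1 by omega]
    have h₃ := Nat.choose_succ_succ (n + 1 + i) (m + i + 1)
    have h₄ := Nat.choose_succ_succ (m + i + 1) m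
    simp only [Nat.succ_eq_add_one, add_assoc, Nat.reduceAdd] at h₁ h₂ h₃ h₄
    rw [Nat.multichoose_eq, show n + 1 + (i + 1) - 1 = n + 1 + i by omega,
      Nat.choose_succ_succ n m, add_right_comm m 1 i]
    simp only [Nat.succ_eq_add_one, add_assoc]
    rw [h₃, add_mul, mul_comm (n.choose m), mul_comm (n.choose (m + 1)), ← h₁, ← h₂, h₄]
    ring

/-- The recursion trades coefficient degree for form degree, so the induction on j needs all m at
once. It starts from d killing constant forms. -/
theorem finrank_map_formsDeriv (j : ℕ) : ∀ (m : ℕ),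
    (∀ c : ℕ, 1 ≤ c → c ≤ j + 1 → (c : K) ≠ 0) →
    finrank K ((formsSpan K n {j + 1} m).map (formsDeriv K n)) =
      (m + j).choose m * (n + j).choose (m + j + 1) := by
  induction j with
  | zero =>
    intro m hj
    have := finrank_map_formsDeriv_add (n := n) (m := m) hj
    rw [map_formsDeriv_formsSpan_zero, finrank_bot] at this
    simpa using this
  | succ i ih =>
    intro m hj
    have := finrank_map_formsDeriv_add (n := n) (m := m) hj
    rw [ih (m + 1) (fun c h1 h2 => hj c h1 (by omega)), ← choose_mul_choose_add] at this
    rw [show m + 1 + i + 1 = m + i + 2 by omega] at this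
    exact Nat.add_right_cancel this

end FormsSpan

/-! ### The wedge ideal of 𝔮^(j+1) and the forms on the truncated polynomial ring -/

section Wedge

open Module MvPolynomial

variable {K : Type*} [Field K] {n : ℕ} {m : ℕ}

theorem dXProd_mem_kaehlerForms (l : List (Fin n)) :
    dXProd K l ∈ kaehlerForms K (MvPolynomial (Fin n) K) l.length := by
  rw [kaehlerForms, ExteriorAlgebra.exteriorPower]
  induction l with
  | nil =>
    rw [List.length_nil, pow_zero]
    exact Submodule.one_le.mp le_rfl
  | cons i l ih =>
    rw [dXProd_cons, List.length_cons, pow_succ']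
    exact Submodule.mul_mem_mul ⟨_, rfl⟩ ih

theorem formsBasis_mem_kaehlerForms {s : Finset (Fin n)} (hs : s.card = m) :
    formsBasis K n s ∈ kaehlerForms K (MvPolynomial (Fin n) K) m := by
  obtain ⟨l, hl, rfl, h⟩ := exists_formsBasis_eq_dXProd K s
  rw [h, ← hs, List.toFinset_card_of_nodup hl]
  exact dXProd_mem_kaehlerForms l

theorem smul_mem_formsSpan_of_add {P P' P'' : Set ℕ} (hP : ∀ a ∈ P, ∀ b ∈ P', a + b ∈ P'')
    {f : MvPolynomial (Fin n) K} (hf : ∀ u ∈ f.support, u.degree ∈ P)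
    {x : PolyForms K n} (hx : x ∈ formsSpan K n P' m) : f • x ∈ formsSpan K n P'' m := by
  rw [f.as_sum, Finset.sum_smul]
  refine Submodule.sum_mem _ fun u hu => ?_
  have h : formsSpan K n P' m ≤ (formsSpan K n P'' m).comap
      ((LinearMap.lsmul (MvPolynomial (Fin n) K) (PolyForms K n)
        (monomial u (coeff u f))).restrictScalars K) := by
    refine formsSpan_le fun v s hv hs => ?_
    have hl : ((LinearMap.lsmul (MvPolynomial (Fin n) K) (PolyForms K n)
        (monomial u (coeff u f))).restrictScalars K) (monomial v (1 : K) • formsBasis K n s) =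
          monomial u (coeff u f) • monomial v (1 : K) • formsBasis K n s := rfl
    rw [Submodule.mem_comap, hl, smul_smul, monomial_mul]
    refine monomial_smul_mem_formsSpan ?_ _ (formsBasis_mem_constForms K hs)
    rw [map_add]
    exact hP _ (hf u hu) _ hv
  exact h hx

theorem kaehlerForms_eq_formsSpan (K : Type*) [Field K] (n m : ℕ) :
    (kaehlerForms K (MvPolynomial (Fin n) K) m).restrictScalars K =
      formsSpan K n Set.univ m := by
  refine le_antisymm (fun x hx => ?_) (formsSpan_le fun u s _ hs =>
    Submodule.smul_mem (kaehlerForms K (MvPolynomial (Fin n) K) m) _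
      (formsBasis_mem_kaehlerForms hs))
  have hspan : Submodule.span (MvPolynomial (Fin n) K)
      (Set.range (KaehlerDifferential.mvPolynomialBasis K (Fin n))) = ⊤ := Basis.span_eq _
  rw [Submodule.restrictScalars_mem, kaehlerForms,
    ← exteriorPower.ιMulti_span_fixedDegree_of_span_eq_top _ _ _ hspan] at hx
  induction hx using Submodule.span_induction with
  | mem x hx =>
    obtain ⟨w, hw, rfl⟩ := hx
    choose s hs using fun i => hw ⟨i, rfl⟩
    have h : ExteriorAlgebra.ιMulti _ m w = dXProd K (List.ofFn s) := by
      rw [ExteriorAlgebra.ιMulti_apply, dXProd, List.map_ofFn]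
      congr 2
      ext i
      rw [← hs i, KaehlerDifferential.mvPolynomialBasis_apply]
      rfl
    rw [h, ← one_smul (MvPolynomial (Fin n) K) (dXProd K (List.ofFn s))]
    exact smul_mem_formsSpan (fun _ _ => Set.mem_univ _) (dXProd_mem_constForms (by simp))
  | zero => exact zero_mem _
  | add x y _ _ hx hy => exact add_mem hx hy
  | smul a x _ hx =>
    exact smul_mem_formsSpan_of_add (P := Set.univ) (fun _ _ _ _ => Set.mem_univ _)
      (fun _ _ => Set.mem_univ _) hx

theorem formsComponent_eq_formsSpan (K : Type*) [Field K] (n m j : ℕ) :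
    formsComponent K n m (j + m) = formsSpan K n {j} m := by
  refine le_antisymm (Submodule.span_le.mpr ?_) (formsSpan_le fun u s hu hs => ?_)
  · rintro _ ⟨e, f, s, he, hf, rfl⟩
    obtain rfl : e = j := Nat.add_right_cancel he
    have h : ExteriorAlgebra.ιMulti (MvPolynomial (Fin n) K) m
        (fun j => KaehlerDifferential.D K (MvPolynomial (Fin n) K) (X (s j))) =
          dXProd K (List.ofFn s) := by
      rw [ExteriorAlgebra.ιMulti_apply, dXProd, List.map_ofFn]
      rfl
    rw [h]
    refine smul_mem_formsSpan (fun u hu => ?_) (dXProd_mem_constForms (by simp))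
    by_contra h
    exact mem_support_iff.mp hu (hf.coeff_eq_zero h)
  · obtain ⟨l, hl, rfl, h⟩ := exists_formsBasis_eq_dXProd K s
    rw [List.toFinset_card_of_nodup hl] at hs
    subst hs
    refine Submodule.subset_span ⟨j, monomial u 1, l.get, rfl, ?_, ?_⟩
    · exact isHomogeneous_monomial _ hu
    · rw [h, ExteriorAlgebra.ιMulti_apply, dXProd]
      congr 2
      conv_lhs => rw [← List.ofFn_get l, List.map_ofFn]
      rfl

/-- Links the coordinate exterior derivative with the universal derivation that defines `dIdeal`. -/
theorem formsDeriv_monomial_smul (u : Fin n →₀ ℕ) {x : PolyForms K n}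
    (hx : x ∈ constForms K n m) :
    formsDeriv K n (monomial u (1 : K) • x) =
      ExteriorAlgebra.ι _ (KaehlerDifferential.D K (MvPolynomial (Fin n) K) (monomial u 1)) *
        x := by
  rw [formsDeriv_smul _ hx]
  have h : KaehlerDifferential.D K (MvPolynomial (Fin n) K) (monomial u 1) =
      ∑ i, pderiv i (monomial u (1 : K)) • KaehlerDifferential.D K _ (X i) := by
    rw [← (KaehlerDifferential.mvPolynomialBasis K (Fin n)).sum_repr
      (KaehlerDifferential.D K _ (monomial u 1))]
    refine Finset.sum_congr rfl fun i _ => ?_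
    rw [KaehlerDifferential.mvPolynomialBasis_repr_apply,
      KaehlerDifferential.mvPolynomialBasis_apply]
  rw [h, map_sum, Finset.sum_mul]
  refine Finset.sum_congr rfl fun i _ => ?_
  rw [map_smul, smul_mul_assoc]
  rfl

variable (K n) in
/-- The forms `d𝔮^(j+1) ∧ Ω^m`, described through the exterior derivative. -/
theorem dIdealWedge_eq (m j : ℕ) :
    (dIdealWedge K (maxIdeal K n ^ (j + 1)) m).restrictScalars K =
      (formsSpan K n {j + 1} m).map (formsDeriv K n) ⊔
        formsSpan K n (Set.Ici (j + 1)) (m + 1) := by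
  set N := (formsSpan K n {j + 1} m).map (formsDeriv K n) ⊔
        formsSpan K n (Set.Ici (j + 1)) (m + 1)
  have hmem : ∀ u : Fin n →₀ ℕ, j + 1 ≤ u.degree →
      monomial u (1 : K) ∈ maxIdeal K n ^ (j + 1) := fun u hu =>
    (monomial_mem_pow_idealOfVars_iff (j + 1) u one_ne_zero).mpr hu
  have hsmul : ∀ (f : MvPolynomial (Fin n) K), ∀ x ∈ N, f • x ∈ N := by
    intro f x hx
    obtain ⟨y, hy, z, hz, rfl⟩ := Submodule.mem_sup.mp hx
    rw [smul_add]
    refine add_mem ?_ (Submodule.mem_sup_right (smul_mem_formsSpan_of_add (P := Set.univ)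
      (fun a _ b hb => le_trans hb (Nat.le_add_left b a)) (fun _ _ => trivial) hz))
    -- Exact forms are stable only under constants; the rest of f raises the coefficient degree from
    -- j to at least j + 1.
    have hf : f • y = coeff 0 f • y + (f - C (coeff 0 f)) • y := by
      rw [sub_smul, ← algebraMap_eq, algebraMap_smul, add_sub_cancel]
    rw [hf]
    refine add_mem (Submodule.smul_mem _ _ (Submodule.mem_sup_left hy))
      (Submodule.mem_sup_right ?_)
    refine smul_mem_formsSpan_of_add (P := Set.Ici 1) (P' := {j}) ?_ ?_
      (map_formsDeriv_formsSpan_le j hy)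
    · intro a ha b hb
      rw [Set.mem_Ici] at *
      rw [Set.mem_singleton_iff] at hb
      omega
    · intro u hu
      rw [Set.mem_Ici, Nat.one_le_iff_ne_zero, Ne, Finsupp.degree_eq_zero_iff]
      rintro rfl
      simp at hu
  have hgen : ∀ u : Fin n →₀ ℕ, j + 1 ≤ u.degree → ∀ x ∈ constForms K n m,
      ExteriorAlgebra.ι _ (KaehlerDifferential.D K (MvPolynomial (Fin n) K) (monomial u 1)) * x
        ∈ N := by
    intro u hu x hx
    rw [← formsDeriv_monomial_smul u hx]
    -- Degree exactly j + 1 gives the exact part; in higher degree the derivative still has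
    -- coefficients of degree at least j + 1.
    obtain h | h := hu.eq_or_lt
    · exact Submodule.mem_sup_left ⟨_, monomial_smul_mem_formsSpan h.symm _ hx, rfl⟩
    · obtain ⟨i, hi⟩ : ∃ i, u.degree = i + 1 := ⟨u.degree - 1, by omega⟩
      refine Submodule.mem_sup_right (formsSpan_mono ?_ (map_formsDeriv_formsSpan_le i
        ⟨_, monomial_smul_mem_formsSpan hi _ hx, rfl⟩))
      rw [Set.singleton_subset_iff, Set.mem_Ici]
      omega
  apply le_antisymm
  · intro x hx
    rw [Submodule.restrictScalars_mem] at hx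
    induction hx using Submodule.mul_induction_on' with
    | add x _ y _ hx hy => exact add_mem hx hy
    | mem_mul_mem w hw η hη =>
      obtain ⟨w, hw, rfl⟩ := hw
      induction hw using Submodule.span_induction with
      | zero => simp
      | add x y _ _ hx hy => rw [map_add, add_mul]; exact add_mem hx hy
      | smul a x _ hx => rw [map_smul, smul_mul_assoc]; exact hsmul a _ hx
      | mem w hw =>
        obtain ⟨f, hf, rfl⟩ := hw
        rw [f.as_sum, map_sum, map_sum, Finset.sum_mul]
        refine Submodule.sum_mem _ fun u hu => ?_
        have hu' : j + 1 ≤ u.degree := (mem_pow_idealOfVars_iff (j + 1) f).mp hf u hu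
        have hc : monomial u (coeff u f) = coeff u f • monomial u (1 : K) := by
          simp [smul_monomial]
        rw [hc, Derivation.map_smul, LinearMap.map_smul_of_tower, smul_mul_assoc]
        refine Submodule.smul_mem _ _ ?_
        have hη' : η ∈ formsSpan K n Set.univ m := by
          rw [← kaehlerForms_eq_formsSpan]; exact hη
        have hle : formsSpan K n Set.univ m ≤ N.comap (LinearMap.mulLeft K
            (ExteriorAlgebra.ι _
              (KaehlerDifferential.D K (MvPolynomial (Fin n) K) (monomial u 1)))) := by
          refine formsSpan_le fun v s _ hs => ?_
          rw [Submodule.mem_comap, LinearMap.mulLeft_apply, mul_smul_comm]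
          exact hsmul _ _ (hgen u hu' _ (formsBasis_mem_constForms K hs))
        exact hle hη'
  · refine sup_le (Submodule.map_le_iff_le_comap.mpr ?_) ?_
    · refine formsSpan_le fun u s hu hs => ?_
      rw [Submodule.mem_comap, formsDeriv_monomial_smul u (formsBasis_mem_constForms K hs)]
      have hD : KaehlerDifferential.D K (MvPolynomial (Fin n) K) (monomial u 1) ∈
          dIdeal K (maxIdeal K n ^ (j + 1)) :=
        Submodule.subset_span ⟨_, hmem u (Set.mem_singleton_iff.mp hu).ge, rfl⟩
      rw [Submodule.restrictScalars_mem, dIdealWedge]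
      exact Submodule.mul_mem_mul (Submodule.mem_map_of_mem hD) (formsBasis_mem_kaehlerForms hs)
    · refine formsSpan_le fun u s hu hs => ?_
      rw [Submodule.restrictScalars_mem]
      exact smul_mem_dIdealWedge _ (hmem u hu) (formsBasis_mem_kaehlerForms hs)

/-- The modular law removes the part of coefficient degree above j. `P = {j}` serves (a), and `P =
Set.Iic j` serves (b). -/
theorem dIdealWedge_inf_formsSpan {P : Set ℕ} {j : ℕ} (hj : j ∈ P) (hP : P ⊆ Set.Iic j) :
    (dIdealWedge K (maxIdeal K n ^ (j + 1)) m).restrictScalars K ⊓ formsSpan K n P (m + 1) =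
      (formsSpan K n {j + 1} m).map (formsDeriv K n) := by
  have hle : (formsSpan K n {j + 1} m).map (formsDeriv K n) ≤ formsSpan K n P (m + 1) :=
    (map_formsDeriv_formsSpan_le j).trans (formsSpan_mono (Set.singleton_subset_iff.mpr hj))
  have hdisj : Disjoint (formsSpan K n (Set.Ici (j + 1)) (m + 1)) (formsSpan K n P (m + 1)) := by
    refine (monoBasis K n).linearIndependent.disjoint_span_image ?_
    rw [Set.disjoint_left]
    rintro p ⟨hp, -⟩ ⟨hp', -⟩
    have h1 : j + 1 ≤ p.1.degree := hp
    have h2 : p.1.degree ≤ j := hP hp'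
    omega
  rw [dIdealWedge_eq, sup_inf_assoc_of_le _ hle, hdisj.eq_bot, sup_bot_eq]

theorem formsSpan_univ_le (K : Type*) [Field K] (n m j : ℕ) :
    formsSpan K n Set.univ m ≤
      formsSpan K n (Set.Iic j) m ⊔ formsSpan K n (Set.Ici (j + 1)) m := by
  refine formsSpan_le fun u s _ hs => ?_
  rcases Nat.lt_or_ge j u.degree with h | h
  · exact Submodule.mem_sup_right
      (monomial_smul_mem_formsSpan h _ (formsBasis_mem_constForms K hs))
  · exact Submodule.mem_sup_left
      (monomial_smul_mem_formsSpan h _ (formsBasis_mem_constForms K hs))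

-- Forms with coefficients of degree at most j already surject onto the forms on the quotient, since
-- higher ones vanish there; the kernel consists of the exact forms in coefficient degree j.
variable (K n) in
theorem finrank_kaehlerForms_quotient (m j : ℕ) :
    Module.Finite K (kaehlerForms K (MvPolynomial (Fin n) K ⧸ maxIdeal K n ^ (j + 1)) (m + 1)) ∧
    finrank K (kaehlerForms K (MvPolynomial (Fin n) K ⧸ maxIdeal K n ^ (j + 1)) (m + 1)) +
      finrank K ((formsSpan K n {j + 1} m).map (formsDeriv K n)) =
        n.choose (m + 1) * (n + j).choose n := by
  obtain ⟨hfin, hrank⟩ := finrank_formsSpan_Iic (K := K) (n := n) (m := m + 1) j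
  let T := formsSpan K n (Set.Iic j) (m + 1)
  let Φ := (formsQuotMap K (maxIdeal K n ^ (j + 1))).toLinearMap.restrictScalars K
  have hW := dIdealWedge_eq K n m j
  have hΦ : ∀ x, Φ x = formsQuotMap K (maxIdeal K n ^ (j + 1)) x := fun _ => rfl
  have hmap : (kaehlerForms K (MvPolynomial (Fin n) K ⧸ maxIdeal K n ^ (j + 1))
      (m + 1)).restrictScalars K = T.map Φ := by
    have h := kaehlerForms_eq_map (K := K) (maxIdeal K n ^ (j + 1)) (m + 1)
    ext y
    have hy : y ∈ kaehlerForms K (MvPolynomial (Fin n) K ⧸ maxIdeal K n ^ (j + 1)) (m + 1) ↔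
        y ∈ (kaehlerForms K (MvPolynomial (Fin n) K) (m + 1)).map
          (formsQuotMap K (maxIdeal K n ^ (j + 1))).toLinearMap := by
      rw [← h, Submodule.restrictScalars_mem]
    rw [Submodule.restrictScalars_mem, hy]
    constructor
    · rintro ⟨x, hx, rfl⟩
      have hx' : x ∈ formsSpan K n Set.univ (m + 1) := by
        rw [← kaehlerForms_eq_formsSpan]; exact hx
      obtain ⟨t, ht, z, hz, rfl⟩ := Submodule.mem_sup.mp (formsSpan_univ_le K n (m + 1) j hx')
      refine ⟨t, ht, ?_⟩
      have hz' : z ∈ (dIdealWedge K (maxIdeal K n ^ (j + 1)) m).restrictScalars K :=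
        hW ▸ Submodule.mem_sup_right hz
      rw [AlgHom.toLinearMap_apply, map_add, formsQuotMap_eq_zero_of_mem_dIdealWedge _ hz',
        add_zero, hΦ]
    · rintro ⟨t, ht, rfl⟩
      refine ⟨t, ?_, rfl⟩
      have := formsSpan_mono (Set.subset_univ _) ht
      rwa [← kaehlerForms_eq_formsSpan] at this
  have hker : (formsSpan K n {j + 1} m).map (formsDeriv K n) =
      (LinearMap.ker (Φ.domRestrict T)).map T.subtype := by
    rw [← dIdealWedge_inf_formsSpan (P := Set.Iic j) Set.self_mem_Iic le_rfl]
    ext x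
    constructor
    · rintro ⟨hx, hx'⟩
      exact ⟨⟨x, hx'⟩, formsQuotMap_eq_zero_of_mem_dIdealWedge _ hx, rfl⟩
    · rintro ⟨⟨x, hx⟩, hx', rfl⟩
      refine ⟨mem_dIdealWedge_of_formsQuotMap_eq_zero _ ?_ hx', hx⟩
      have := formsSpan_mono (Set.subset_univ _) hx
      rwa [← kaehlerForms_eq_formsSpan] at this
  have hfin' : Module.Finite K ((kaehlerForms K
      (MvPolynomial (Fin n) K ⧸ maxIdeal K n ^ (j + 1)) (m + 1)).restrictScalars K) := by
    rw [hmap]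
    exact Module.Finite.map T Φ
  refine ⟨hfin', ?_⟩
  change finrank K ((kaehlerForms K
      (MvPolynomial (Fin n) K ⧸ maxIdeal K n ^ (j + 1)) (m + 1)).restrictScalars K) + _ = _
  rw [hmap, hker, ← hrank, ← LinearMap.finrank_range_add_finrank_ker (Φ.domRestrict T),
    LinearMap.range_domRestrict]
  congr 1
  exact LinearEquiv.finrank_eq
    (Submodule.equivMapOfInjective _ (Submodule.injective_subtype _) _).symm

/-! ### Translation into integer binomials, and conclusion -/

theorem binom_natCast (a b : ℕ) : binom a b = a.choose b := by
  simp [binom]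

theorem binom_of_right_neg {a b : ℤ} (hb : b < 0) : binom a b = 0 :=
  if_neg fun h => absurd h.2 (not_le.mpr hb)

theorem binom_mul_binom_first (n l j : ℕ) :
    binom n (l + 1 : ℕ) * binom (n + (j + 1 : ℕ) - 2) (n - 1) =
      (n.choose (l + 1) * n.multichoose j : ℕ) := by
  rcases n with - | n
  · rw [binom_natCast]
    simp
  · rw [show ((n + 1 : ℕ) : ℤ) + (j + 1 : ℕ) - 2 = (n + j : ℕ) by push_cast; ring,
      show ((n + 1 : ℕ) : ℤ) - 1 = (n : ℕ) by push_cast; ring, binom_natCast, binom_natCast,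
      Nat.multichoose_eq, show n + 1 + j - 1 = n + j by omega, Nat.choose_symm_add]
    push_cast
    rfl

theorem binom_mul_binom_second (n l j : ℕ) (hj : ∀ c : ℕ, 1 ≤ c → c ≤ j → (c : K) ≠ 0) :
    binom ((l + 1 : ℕ) + (j + 1 : ℕ) - 2) (l + 1 : ℕ) *
        binom (n + (j + 1 : ℕ) - 2) (n - (l + 1 : ℕ) - 1) =
      finrank K ((formsSpan K n {j} (l + 1)).map (formsDeriv K n)) := by
  rw [show ((l + 1 : ℕ) : ℤ) + (j + 1 : ℕ) - 2 = (l + j : ℕ) by push_cast; ring, binom_natCast]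
  -- For j = 0 (k = 1) both sides vanish: constant forms are closed, and the first binomial is `l`
  -- choose `l + 1`.
  rcases j with - | i
  · rw [map_formsDeriv_formsSpan_zero, finrank_bot]
    simp
  · rw [finrank_map_formsDeriv i (l + 1) hj, show l + (i + 1) = l + 1 + i by omega]
    -- Below l + 2 the lower entry n - m - 1 is negative, so the zero convention applies.
    rcases Nat.lt_or_ge n (l + 2) with h | h
    · rw [binom_of_right_neg (by omega),
        Nat.choose_eq_zero_of_lt (show n + i < l + 1 + i + 1 by omega)]
      simp
    · obtain ⟨r, rfl⟩ := Nat.exists_eq_add_of_le h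
      rw [show ((l + 2 + r : ℕ) : ℤ) + (i + 1 + 1 : ℕ) - 2 = (l + 2 + r + i : ℕ) by
          push_cast; ring,
        show ((l + 2 + r : ℕ) : ℤ) - (l + 1 : ℕ) - 1 = (r : ℕ) by push_cast; ring, binom_natCast,
        Nat.choose_symm_of_eq_add (show l + 2 + r + i = r + (l + 1 + i + 1) by omega)]
      push_cast
      rfl

theorem binom_mul_binom_third (n l j : ℕ) :
    binom n (l + 1 : ℕ) * binom (n + (j + 1 : ℕ) - 2) n + (n.choose (l + 1) * n.multichoose j : ℕ) =
      (n.choose (l + 1) * (n + j).choose n : ℕ) := by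
  rcases n with - | n
  · rw [binom_natCast]
    simp
  · rw [show ((n + 1 : ℕ) : ℤ) + (j + 1 : ℕ) - 2 = (n + j : ℕ) by push_cast; ring,
      binom_natCast, binom_natCast, Nat.multichoose_eq, show n + 1 + j - 1 = n + j by omega,
      ← Nat.choose_symm_add, add_right_comm n 1 j, Nat.choose_succ_succ (n + j) n,
      Nat.succ_eq_add_one]
    push_cast
    ring

end Wedge

theorem mainTheorem3 (K : Type*) [Field K] (n k : ℕ) (hk : 1 ≤ k)
    (hK : ringChar K = 0 ∨ k < ringChar K) :
    (∀ m : ℕ, 1 ≤ m →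
      Module.Finite K (dPowWedgeComponent K n k m (m + k - 1)) ∧
      (Module.finrank K (dPowWedgeComponent K n k m (m + k - 1)) : ℤ) =
        binom n m * binom (n + k - 2) (n - 1) -
          binom (m + k - 2) m * binom (n + k - 2) (n - m - 1)) ∧
    (∀ m : ℕ, 1 ≤ m →
      Module.Finite K (kaehlerForms K (MvPolynomial (Fin n) K ⧸ maxIdeal K n ^ k) m) ∧
      (Module.finrank K (kaehlerForms K (MvPolynomial (Fin n) K ⧸ maxIdeal K n ^ k) m) : ℤ) =
        binom n m * binom (n + k - 2) n +
          binom (m + k - 2) m * binom (n + k - 2) (n - m - 1)) := by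
  obtain ⟨j, rfl⟩ : ∃ j, k = j + 1 := ⟨k - 1, by omega⟩
  have hc : ∀ c : ℕ, 1 ≤ c → c ≤ j + 1 → (c : K) ≠ 0 := by
    intro c h1 h2 h0
    rw [ringChar.spec] at h0
    rcases hK with hK | hK
    · rw [hK, zero_dvd_iff] at h0
      omega
    · have := Nat.le_of_dvd h1 h0
      omega
  refine ⟨fun m hm => ?_, fun m hm => ?_⟩ <;>
    obtain ⟨l, rfl⟩ : ∃ l, m = l + 1 := ⟨m - 1, by omega⟩
  · have h : dPowWedgeComponent K n (j + 1) (l + 1) (l + 1 + (j + 1) - 1) =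
        (formsSpan K n {j + 1} l).map (formsDeriv K n) := by
      rw [dPowWedgeComponent, show l + 1 + (j + 1) - 1 = j + (l + 1) by omega,
        formsComponent_eq_formsSpan]
      exact dIdealWedge_inf_formsSpan (Set.mem_singleton j)
        (Set.singleton_subset_iff.mpr Set.self_mem_Iic)
    have := (finrank_formsSpan_singleton (K := K) (n := n) (m := l) (j + 1)).1
    -- The subtracted product is the rank of d on m-forms with coefficients of degree j, so the
    -- difference is the dimension of the closed, hence exact, ones.
    rw [h, binom_mul_binom_first,
      binom_mul_binom_second (K := K) n l j (fun c h1 h2 => hc c h1 (by omega)),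
      ← finrank_map_formsDeriv_add hc]
    refine ⟨Module.Finite.map _ _, ?_⟩
    push_cast
    ring
  · obtain ⟨hfin, hrank⟩ := finrank_kaehlerForms_quotient K n l j
    refine ⟨hfin, ?_⟩
    have h3 := binom_mul_binom_third n l j
    rw [← hrank, ← finrank_map_formsDeriv_add (K := K) hc] at h3
    rw [binom_mul_binom_second (K := K) n l j (fun c h1 h2 => hc c h1 (by omega))]
    push_cast at h3 ⊢
    linarith
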